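/- Let $N\ge 3$ be an integer, $\alpha\in(0,N)$, and let $p,q>0$ satisfy $$\frac{2(N+\alpha)}{N}<p+q<\frac{2(N+\alpha)}{N-2},\qquad \frac{N(p+q)}{(N+\alpha)p}>1,\qquad \frac{N(p+q)}{(N+\alpha)q}>1 .$$ Let $I_\alpha(x)=\dfrac{\Gamma(\frac{N-\alpha}{2})}{\pi^{N/2}2^{\alpha}\Gamma(\frac{\alpha}{2})}\,|x|^{\alpha-N}$ be the Riesz potential on $\mathbb{R}^N$. Let $(w_m)_{m\in\mathbb{N}}$ be a bounded sequence of real-valued functions in $L^{\frac{N(p+q)}{N+\alpha}}(\mathbb{R}^N)$ such that (i) $w_m$ converges weakly to $w$ in $L^{\frac{N(p+q)}{N+\alpha}}(\mathbb{R}^N)$; (ii) $w_m\to w$ almost everywhere on $\mathbb{R}^N$. Then, for each $u\in\{w_m,\ w_m-w,\ w : m\in\mathbb{N}\}$, the convolution $I_\alpha*|u|^p$ is finite almost everywhere and $(I_\alpha*|u|^p)|u|^q$ is integrable, and $$\lim_{m\to\infty}\left[\int_{\mathbb{R}^N}(I_\alpha*|w_m|^p)(x)|w_m(x)|^q\,dx-\int_{\mathbb{R}^N}(I_\alpha*|w_m-w|^p)(x)|(w_m-w)(x)|^q\,dx\right]=\int_{\mathbb{R}^N}(I_\alpha*|w|^p)(x)|w(x)|^q\,dx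 .$$ -/

import Mathlib

open MeasureTheory Filter Topology
open scoped ENNReal

noncomputable section

/-- The Riesz potential
`I_α(x) = Γ((N-α)/2) |x|^(α-N) / (π^(N/2) 2^α Γ(α/2))` on `ℝ^N`. (Its value at the origin, a null
set, is immaterial.) -/
def rieszPotential (N : ℕ) (α : ℝ) (x : EuclideanSpace ℝ (Fin N)) : ℝ :=
  Real.Gamma (((N : ℝ) - α) / 2) * ‖x‖ ^ (α - (N : ℝ)) /
    (Real.pi ^ ((N : ℝ) / 2) * (2 : ℝ) ^ α * Real.Gamma (α / 2))

/-- The function `I_α ∗ |u|^p` on `ℝ^N`. -/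
def rieszConv {N : ℕ} (α p : ℝ) (u : EuclideanSpace ℝ (Fin N) → ℝ) :
    EuclideanSpace ℝ (Fin N) → ℝ :=
  convolution (rieszPotential N α) (fun y => |u y| ^ p) (ContinuousLinearMap.mul ℝ ℝ) volume

/-- The nonlocal energy `∫ (I_α ∗ |u|^p)(x) |u(x)|^q dx`. -/
def choquardIntegral {N : ℕ} (α p q : ℝ) (u : EuclideanSpace ℝ (Fin N) → ℝ) : ℝ :=
  ∫ x, rieszConv α p u x * |u x| ^ q

/-- The integral `∫ (I_α ∗ |u|^p)(x) |u(x)|^q dx` is meaningful and finite: the convolution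
integral converges at almost every point, and the outer integrand is integrable. -/
def ChoquardFinite {N : ℕ} (α p q : ℝ) (u : EuclideanSpace ℝ (Fin N) → ℝ) : Prop :=
  (∀ᵐ x, ConvolutionExistsAt (rieszPotential N α) (fun y => |u y| ^ p) x
      (ContinuousLinearMap.mul ℝ ℝ) volume) ∧
    Integrable (fun x => rieszConv α p u x * |u x| ^ q)

/-- Boundedness of a sequence in `L^s(ℝ^N)`. -/
def BoundedInLp {N : ℕ} (s : ℝ≥0∞) (w : ℕ → EuclideanSpace ℝ (Fin N) → ℝ) : Prop :=
  (∀ m, MemLp (w m) s) ∧ ∃ C : ℝ, ∀ m, eLpNorm (w m) s volume ≤ ENNReal.ofReal C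

/-- Weak convergence in `L^s(ℝ^N)`, `1 < s < ∞`: all functions lie in `L^s`, and
`∫ w_m g → ∫ w g` for every `g` in `L^{s'}`, where `1/s + 1/s' = 1`. -/
def TendstoWeaklyInLp {N : ℕ} (s : ℝ≥0∞) (w : ℕ → EuclideanSpace ℝ (Fin N) → ℝ)
    (w₀ : EuclideanSpace ℝ (Fin N) → ℝ) : Prop :=
  (∀ m, MemLp (w m) s) ∧ MemLp w₀ s ∧
    ∀ g : EuclideanSpace ℝ (Fin N) → ℝ, MemLp g (ENNReal.conjExponent s) →
      Tendsto (fun m => ∫ x, w m x * g x) atTop (𝓝 (∫ x, w₀ x * g x))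

end

/-!
The energy `∫ (I_α ∗ |u|^p) |u|^q` is the integral of
`I_α(x - y) |u(y)|^p |u(x)|^q` over pairs `(x, y)`, and the theorem is a Brezis–Lieb lemma on this
product space.

With `s = N (p + q) / (N + α)`, the functions `|u|^p` and `|u|^q` lie in `L^{s/p}` and `L^{s/q}`,
whose exponents satisfy the Hardy–Littlewood–Sobolev relation. That inequality
(`hardy_littlewood_sobolev`) is proved directly: where `f(y)^t ≤ g(x)^r`, the inner integral over
`y` is split at the radius `g(x)^(-r/N)`; near `x` the pointwise bound on `f` is used, far from `x`
Hölder's inequality, and both contributions are multiples of `g(x)^(r-1)`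
(`exists_lintegral_sublevel_le`). It gives the finiteness statements.

For the limit, write `v_m = w_m - w`. The elementary inequality `exists_abs_rpow_mul_rpow_sub_le`
bounds the difference of the densities of `w_m`, `v_m` and `w` by a small multiple of the density
of `v_m`, a multiple of the density of `w`, and the cross terms `|w(y)|^p |v_m(x)|^q` and
`|v_m(y)|^p |w(x)|^q`. The first is bounded in `L^1`, the second is a fixed integrable function, and
the cross terms tend to zero in mean (`tendsto_rieszPairing_zero`): the Riesz potential of `|w|^p`
lies in the dual of `L^{s/q}` (by the converse of Hölder's inequality,
`lintegral_rpow_le_of_forall_lintegral_mul_le`), while `|v_m|^q` is bounded in `L^{s/q}` and tends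
to zero almost everywhere, hence weakly (`tendsto_lintegral_mul_zero`). Dominated convergence in
the form `tendsto_lintegral_zero_of_le_add` concludes.
-/

/-! ### The Hardy–Littlewood–Sobolev inequality -/

section HardyLittlewoodSobolev

open Module

variable {E : Type*} [NormedAddCommGroup E] [NormedSpace ℝ E] [FiniteDimensional ℝ E]
  [MeasurableSpace E] [BorelSpace E] (μ : Measure E) [μ.IsAddHaarMeasure]

theorem lintegral_comp_smul_of_pos (F : E → ℝ≥0∞) {R : ℝ} (hR : 0 < R) :
    ∫⁻ x, F x ∂μ = ENNReal.ofReal (R ^ finrank ℝ E) * ∫⁻ x, F (R • x) ∂μ := by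
  have h : ∫⁻ x, F (R • x) ∂μ = ∫⁻ y, F y ∂Measure.map (fun x => R • x) μ :=
    (lintegral_map_equiv F
      (Homeomorph.smul (isUnit_iff_ne_zero.2 hR.ne').unit).toMeasurableEquiv).symm
  have hd : 0 < R ^ finrank ℝ E := by positivity
  rw [h, Measure.map_addHaar_smul μ hR.ne', lintegral_smul_measure, smul_eq_mul, ← mul_assoc,
    ← ENNReal.ofReal_mul hd.le, abs_of_pos (inv_pos.2 hd), mul_inv_cancel₀ hd.ne']
  simp

/-- Homogeneity of the power weight `‖z‖ ^ a` on the sets `{‖z‖ / R ∈ T}`. -/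
theorem lintegral_norm_rpow_scale (T : Set ℝ) (a : ℝ) {R : ℝ} (hR : 0 < R) :
    ∫⁻ z, {z : E | ‖z‖ / R ∈ T}.indicator (fun z => ENNReal.ofReal (‖z‖ ^ a)) z ∂μ =
      ENNReal.ofReal (R ^ ((finrank ℝ E : ℝ) + a)) *
        ∫⁻ z, {z : E | ‖z‖ ∈ T}.indicator (fun z => ENNReal.ofReal (‖z‖ ^ a)) z ∂μ := by
  rw [lintegral_comp_smul_of_pos μ _ hR, Real.rpow_add hR, Real.rpow_natCast,
    ENNReal.ofReal_mul (by positivity), mul_assoc,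
    ← lintegral_const_mul' (ENNReal.ofReal (R ^ a)) _ ENNReal.ofReal_ne_top]
  congr 2
  ext z
  have h1 : ‖R • z‖ = R * ‖z‖ := by rw [norm_smul, Real.norm_of_nonneg hR.le]
  by_cases hz : ‖z‖ ∈ T
  · rw [Set.indicator_of_mem, Set.indicator_of_mem (by exact hz), h1,
      Real.mul_rpow hR.le (norm_nonneg _), ENNReal.ofReal_mul (by positivity)]
    simpa [h1, hR.ne'] using hz
  · rw [Set.indicator_of_notMem, Set.indicator_of_notMem (by exact hz), mul_zero]
    simpa [h1, hR.ne'] using hz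

theorem exists_lintegral_near_le (hd : 1 ≤ finrank ℝ E) {l : ℝ} (hl : l < finrank ℝ E) :
    ∃ C : ℝ≥0∞, C ≠ ⊤ ∧ ∀ R : ℝ, 0 < R →
      ∫⁻ z, {z : E | ‖z‖ / R ∈ Set.Iio 1}.indicator (fun z => ENNReal.ofReal (‖z‖ ^ (-l))) z ∂μ ≤
        C * ENNReal.ofReal (R ^ ((finrank ℝ E : ℝ) - l)) := by
  refine ⟨_, ?_, fun R hR => (lintegral_norm_rpow_scale μ _ (-l) hR).le.trans
    (by rw [mul_comm, sub_eq_add_neg])⟩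
  have h : IntegrableOn (fun z : E => ‖z‖ ^ (-l)) (Metric.ball 0 1) μ := by
    refine integrableOn_ball_of_norm_le_rpow (C := 1) hd hl (ae_of_all _ fun x => ?_)
      (by fun_prop : Measurable _).aestronglyMeasurable
    rw [Real.norm_of_nonneg (by positivity), one_mul]
  have hs : {z : E | ‖z‖ ∈ Set.Iio 1} = Metric.ball 0 1 := by ext; simp
  rw [hs, lintegral_indicator measurableSet_ball]
  exact h.lintegral_lt_top.ne

theorem exists_lintegral_far_le {s : ℝ} (hs : (finrank ℝ E : ℝ) < s) :
    ∃ C : ℝ≥0∞, C ≠ ⊤ ∧ ∀ R : ℝ, 0 < R →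
      ∫⁻ z, {z : E | ‖z‖ / R ∈ Set.Ici 1}.indicator (fun z => ENNReal.ofReal (‖z‖ ^ (-s))) z ∂μ ≤
        C * ENNReal.ofReal (R ^ ((finrank ℝ E : ℝ) - s)) := by
  refine ⟨_, ?_, fun R hR => (lintegral_norm_rpow_scale μ _ (-s) hR).le.trans
    (by rw [mul_comm, sub_eq_add_neg])⟩
  have h := ((integrable_one_add_norm (μ := μ) hs).const_mul (2 ^ s)).lintegral_lt_top
  refine (lt_of_le_of_lt (lintegral_mono fun z => ?_) h).ne
  refine Set.indicator_apply_le' (fun hz => ENNReal.ofReal_le_ofReal ?_) (fun _ => zero_le)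
  have hz : 1 ≤ ‖z‖ := hz
  have hs0 : 0 ≤ s := (Nat.cast_nonneg _).trans hs.le
  rw [Real.rpow_neg (by positivity), Real.rpow_neg (by positivity), ← div_eq_mul_inv,
    inv_eq_one_div, div_le_div_iff₀ (by positivity) (by positivity), one_mul,
    ← Real.mul_rpow (by norm_num) (by positivity)]
  exact Real.rpow_le_rpow (by positivity) (by linarith) hs0

/-- The optimisation step of the Hardy–Littlewood–Sobolev inequality. On the sublevel set
`{g ≤ A ^ (t / r)}` the ball of radius `A ^ (-t / d)` is controlled by the pointwise bound on `g`,
its complement by Hölder's inequality. -/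
theorem exists_lintegral_sublevel_le (hd : 1 ≤ finrank ℝ E) {l t r : ℝ} (ht : 1 < t) (hr : 1 < r)
    (hl : l < finrank ℝ E) (htr : 1 / t + 1 / r + l / finrank ℝ E = 2) {M : ℝ≥0∞} (hM : M ≠ ⊤) :
    ∃ C : ℝ≥0∞, C ≠ ⊤ ∧ ∀ g : E → ℝ≥0∞, Measurable g → ∫⁻ y, g y ^ r ∂μ ≤ M →
      ∀ (x : E) (A : ℝ), 0 < A →
        ∫⁻ y, {y | g y ≤ ENNReal.ofReal (A ^ (t / r))}.indicator
          (fun y => ENNReal.ofReal (‖x - y‖ ^ (-l)) * g y) y ∂μ ≤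
            C * ENNReal.ofReal (A ^ (t - 1)) := by
  set d : ℝ := (finrank ℝ E : ℝ) with hd_def
  have hd0 : 0 < d := by rw [hd_def]; exact_mod_cast hd
  have ht0 : 0 < t := by linarith
  have hr0 : 0 < r := by linarith
  have hr1 : 0 < r - 1 := by linarith
  obtain ⟨C₁, hC₁, h₁⟩ := exists_lintegral_near_le μ hd hl
  set r' := r / (r - 1) with hr'_def
  have hr'0 : 0 < r' := div_pos hr0 hr1
  have hrr' : r.HolderConjugate r' := Real.HolderConjugate.conjExponent hr
  have hl2 : l = d * (2 - 1 / t - 1 / r) := by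
    field_simp at htr ⊢
    linarith
  -- The kernel raised to the power `r'` is integrable at infinity precisely because `t > 1`.
  have hs : d < l * r' := by
    have h1t : 1 / t < 1 := by rw [div_lt_one ht0]; exact ht
    have : l * r' - d = d * (1 - 1 / t) * r' := by
      rw [hl2, hr'_def]; field_simp; ring
    have : 0 < d * (1 - 1 / t) * r' := by
      have : 0 < 1 - 1 / t := by linarith
      positivity
    linarith
  obtain ⟨C₂, hC₂, h₂⟩ := exists_lintegral_far_le μ hs
  refine ⟨C₁ + M ^ (1 / r) * C₂ ^ (1 / r'), ?_, fun g hg hgM x A hA => ?_⟩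
  · finiteness
  -- The radius that balances the two contributions.
  set R : ℝ := A ^ (-(t / d)) with hR_def
  have hR : 0 < R := Real.rpow_pos_of_pos hA _
  set K : E → ℝ≥0∞ := fun z => ENNReal.ofReal (‖z‖ ^ (-l)) with hK_def
  have hKm : Measurable K := by fun_prop
  set S₁ : Set E := {z : E | ‖z‖ / R ∈ Set.Iio 1}
  set S₂ : Set E := {z : E | ‖z‖ / R ∈ Set.Ici 1}
  have hS₁ : MeasurableSet S₁ :=
    measurableSet_Iio.preimage (by fun_prop : Measurable fun z : E => ‖z‖ / R)
  have hS₂ : MeasurableSet S₂ :=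
    measurableSet_Ici.preimage (by fun_prop : Measurable fun z : E => ‖z‖ / R)
  have hm₁ : Measurable fun y => S₁.indicator K (x - y) :=
    (hKm.indicator hS₁).comp (measurable_const.sub measurable_id)
  have hm₂ : Measurable fun y => S₂.indicator K (x - y) :=
    (hKm.indicator hS₂).comp (measurable_const.sub measurable_id)
  have hsplit : ∀ y, {y | g y ≤ ENNReal.ofReal (A ^ (t / r))}.indicator
      (fun y => K (x - y) * g y) y ≤
        ENNReal.ofReal (A ^ (t / r)) * S₁.indicator K (x - y) + g y * S₂.indicator K (x - y) := by
    intro y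
    refine Set.indicator_apply_le' (fun hy => ?_) (fun _ => zero_le)
    rcases lt_or_ge (‖x - y‖ / R) 1 with h | h
    · rw [Set.indicator_of_mem (show x - y ∈ S₁ from h), mul_comm]
      exact le_add_right (mul_le_mul_left hy _)
    · rw [Set.indicator_of_mem (show x - y ∈ S₂ from h), mul_comm]
      exact le_add_self
  calc _ ≤ ∫⁻ y, (ENNReal.ofReal (A ^ (t / r)) * S₁.indicator K (x - y) +
          g y * S₂.indicator K (x - y)) ∂μ := lintegral_mono hsplit
    _ = ENNReal.ofReal (A ^ (t / r)) * ∫⁻ z, S₁.indicator K z ∂μ +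
          ∫⁻ y, g y * S₂.indicator K (x - y) ∂μ := by
        rw [lintegral_add_left (hm₁.const_mul _), lintegral_const_mul _ hm₁,
          lintegral_sub_left_eq_self (S₁.indicator K) x]
    _ ≤ ENNReal.ofReal (A ^ (t / r)) * (C₁ * ENNReal.ofReal (R ^ (d - l))) +
          M ^ (1 / r) * (C₂ * ENNReal.ofReal (R ^ (d - l * r'))) ^ (1 / r') := by
        gcongr
        · exact h₁ R hR
        · refine (ENNReal.lintegral_mul_le_Lp_mul_Lq μ hrr' hg.aemeasurable
            hm₂.aemeasurable).trans ?_
          gcongr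
          refine le_trans (le_of_eq ?_) (h₂ R hR)
          rw [lintegral_sub_left_eq_self (fun z => S₂.indicator K z ^ r') x]
          refine lintegral_congr fun y => ?_
          by_cases h : y ∈ S₂
          · rw [Set.indicator_of_mem h, Set.indicator_of_mem (by exact h), hK_def,
              ENNReal.ofReal_rpow_of_nonneg (by positivity) hr'0.le,
              ← Real.rpow_mul (norm_nonneg _), neg_mul]
          · rw [Set.indicator_of_notMem h, Set.indicator_of_notMem (by exact h),
              ENNReal.zero_rpow_of_pos hr'0]
    _ = _ := by
        have e₁ : t / r + -(t / d) * (d - l) = t - 1 := by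
          rw [hl2]; field_simp; ring
        have e₂ : -(t / d) * ((d - l * r') * (1 / r')) = t - 1 := by
          rw [hl2, hr'_def]; field_simp; ring
        rw [ENNReal.mul_rpow_of_nonneg _ _ (by positivity),
          ENNReal.ofReal_rpow_of_nonneg (by positivity) (by positivity), mul_left_comm,
          ← ENNReal.ofReal_mul (by positivity), hR_def, ← Real.rpow_mul hA.le,
          ← Real.rpow_mul hA.le, ← Real.rpow_mul hA.le, ← Real.rpow_add hA, mul_assoc, e₁, e₂,
          add_mul, mul_assoc]

/-- The part of the Hardy–Littlewood–Sobolev double integral where `f y ^ t ≤ g x ^ r`. The inner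
integral is at most a multiple of `g x ^ (r - 1)`, so the outer one is at most a multiple of
`∫ g ^ r`. -/
theorem exists_lintegral_lintegral_sublevel_le (hd : 1 ≤ finrank ℝ E) {l t r : ℝ} (ht : 1 < t)
    (hr : 1 < r) (hl : l < finrank ℝ E) (htr : 1 / t + 1 / r + l / finrank ℝ E = 2) {M : ℝ≥0∞}
    (hM : M ≠ ⊤) :
    ∃ C : ℝ≥0∞, C ≠ ⊤ ∧ ∀ f g : E → ℝ≥0∞, Measurable f → Measurable g →
      ∫⁻ y, f y ^ t ∂μ ≤ M → ∫⁻ x, g x ^ r ∂μ ≤ M →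
        ∫⁻ x, ∫⁻ y, {y | f y ^ t ≤ g x ^ r}.indicator
          (fun y => ENNReal.ofReal (‖x - y‖ ^ (-l)) * f y * g x) y ∂μ ∂μ ≤ C := by
  have ht0 : 0 < t := by linarith
  have hr0 : 0 < r := by linarith
  obtain ⟨C, hC, h⟩ := exists_lintegral_sublevel_le μ hd hr ht hl
    (by linarith : 1 / r + 1 / t + l / finrank ℝ E = 2) hM
  refine ⟨C * M, by finiteness, fun f g hf hg hfM hgM => ?_⟩
  have hfin : ∀ᵐ x ∂μ, g x ^ r < ⊤ :=
    ae_lt_top (hg.pow_const r) (ne_top_of_le_ne_top hM hgM)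
  calc _ ≤ ∫⁻ x, C * g x ^ r ∂μ := lintegral_mono_ae ?_
    _ = C * ∫⁻ x, g x ^ r ∂μ := lintegral_const_mul _ (hg.pow_const r)
    _ ≤ C * M := by gcongr
  filter_upwards [hfin] with x hx
  have hgx : g x ≠ ⊤ := fun h => by simp [h, hr0] at hx
  rcases eq_or_ne (g x) 0 with h0 | h0
  · simp [h0]
  have hA : 0 < (g x).toReal := ENNReal.toReal_pos h0 hgx
  have hofReal : ∀ a : ℝ, ENNReal.ofReal ((g x).toReal ^ a) = g x ^ a := fun a => by
    rw [← ENNReal.ofReal_rpow_of_pos hA, ENNReal.ofReal_toReal hgx]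
  have key := h f hf hfM x _ hA
  rw [hofReal, hofReal] at key
  have hset : {y | f y ^ t ≤ g x ^ r} = {y | f y ≤ g x ^ (r / t)} := by
    ext y
    have h := ENNReal.rpow_le_rpow_iff (x := f y) (y := g x ^ (r / t)) ht0
    rwa [← ENNReal.rpow_mul, div_mul_cancel₀ _ ht0.ne'] at h
  calc _ = ∫⁻ y, {y | f y ≤ g x ^ (r / t)}.indicator
          (fun y => ENNReal.ofReal (‖x - y‖ ^ (-l)) * f y) y * g x ∂μ := by
        rw [hset]
        refine lintegral_congr fun y => ?_
        by_cases hy : f y ≤ g x ^ (r / t) <;> simp [Set.indicator, hy]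
    _ = (∫⁻ y, {y | f y ≤ g x ^ (r / t)}.indicator
          (fun y => ENNReal.ofReal (‖x - y‖ ^ (-l)) * f y) y ∂μ) * g x :=
        lintegral_mul_const' _ _ hgx
    _ ≤ C * g x ^ (r - 1) * g x := by gcongr
    _ = C * g x ^ r := by
        rw [mul_assoc]
        congr 1
        conv_lhs => enter [2]; rw [← ENNReal.rpow_one (g x)]
        rw [← ENNReal.rpow_add _ _ h0 hgx, sub_add_cancel]

/-- **Hardy–Littlewood–Sobolev inequality**, in the form of a bound that is uniform on bounded
subsets of `L^t × L^r`. The domain is split according to which of `f y ^ t` and `g x ^ r` is larger;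
the two parts are exchanged by the symmetry of the kernel. -/
theorem hardy_littlewood_sobolev (hd : 1 ≤ finrank ℝ E) {l t r : ℝ} (ht : 1 < t)
    (hr : 1 < r) (hl : l < finrank ℝ E) (htr : 1 / t + 1 / r + l / finrank ℝ E = 2) {M : ℝ≥0∞}
    (hM : M ≠ ⊤) :
    ∃ C : ℝ≥0∞, C ≠ ⊤ ∧ ∀ f g : E → ℝ≥0∞, AEMeasurable f μ → AEMeasurable g μ →
      ∫⁻ y, f y ^ t ∂μ ≤ M → ∫⁻ x, g x ^ r ∂μ ≤ M →
        ∫⁻ x, ∫⁻ y, ENNReal.ofReal (‖x - y‖ ^ (-l)) * f y * g x ∂μ ∂μ ≤ C := by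
  obtain ⟨C₁, hC₁, h₁⟩ := exists_lintegral_lintegral_sublevel_le μ hd ht hr hl htr hM
  obtain ⟨C₂, hC₂, h₂⟩ := exists_lintegral_lintegral_sublevel_le μ hd hr ht hl
    (by linarith : 1 / r + 1 / t + l / finrank ℝ E = 2) hM
  have main : ∀ f g : E → ℝ≥0∞, Measurable f → Measurable g →
      ∫⁻ y, f y ^ t ∂μ ≤ M → ∫⁻ x, g x ^ r ∂μ ≤ M →
        ∫⁻ x, ∫⁻ y, ENNReal.ofReal (‖x - y‖ ^ (-l)) * f y * g x ∂μ ∂μ ≤ C₁ + C₂ := by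
    intro f g hf hg hfM hgM
    set φ : E → E → ℝ≥0∞ := fun x y => ENNReal.ofReal (‖x - y‖ ^ (-l)) * f y * g x
    have hφ : Measurable (Function.uncurry φ) := by fun_prop
    set Φ₁ : E → E → ℝ≥0∞ := fun x y => {y | f y ^ t ≤ g x ^ r}.indicator (φ x) y
    set Φ₂ : E → E → ℝ≥0∞ := fun x y => {x | g x ^ r ≤ f y ^ t}.indicator (fun x => φ x y) x
    have hΦ₁ : Measurable (Function.uncurry Φ₁) := by
      exact hφ.indicator (measurableSet_le (by fun_prop) (by fun_prop) :
        MeasurableSet {z : E × E | f z.2 ^ t ≤ g z.1 ^ r})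
    have hΦ₂ : Measurable (Function.uncurry Φ₂) := by
      exact hφ.indicator (measurableSet_le (by fun_prop) (by fun_prop) :
        MeasurableSet {z : E × E | g z.1 ^ r ≤ f z.2 ^ t})
    calc _ ≤ ∫⁻ x, ∫⁻ y, (Φ₁ x y + Φ₂ x y) ∂μ ∂μ := by
          refine lintegral_mono fun x => lintegral_mono fun y => ?_
          rcases le_total (f y ^ t) (g x ^ r) with h | h
          · exact le_add_right (by simp [Φ₁, h, φ])
          · exact le_add_left (by simp [Φ₂, h, φ])
      _ = ∫⁻ x, ∫⁻ y, Φ₁ x y ∂μ ∂μ + ∫⁻ x, ∫⁻ y, Φ₂ x y ∂μ ∂μ := by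
          rw [← lintegral_add_left (Measurable.lintegral_prod_right hΦ₁)]
          refine lintegral_congr fun x => lintegral_add_left (hΦ₁.comp measurable_prodMk_left) _
      _ = ∫⁻ x, ∫⁻ y, Φ₁ x y ∂μ ∂μ + ∫⁻ y, ∫⁻ x, Φ₂ x y ∂μ ∂μ := by
          rw [lintegral_lintegral_swap hΦ₂.aemeasurable]
      _ ≤ C₁ + C₂ := by
          gcongr
          · exact h₁ f g hf hg hfM hgM
          · refine le_trans (le_of_eq ?_) (h₂ g f hg hf hgM hfM)
            refine lintegral_congr fun y => lintegral_congr fun x => ?_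
            simp only [Φ₂, φ, Set.indicator, Set.mem_ofPred_eq, norm_sub_rev y x]
            split_ifs
            · ring
            · rfl
  refine ⟨C₁ + C₂, by finiteness, fun f g hf hg hfM hgM => ?_⟩
  have hf' := hf.ae_eq_mk
  have hg' := hg.ae_eq_mk
  refine le_trans (le_of_eq ?_) (main (hf.mk f) (hg.mk g) hf.measurable_mk hg.measurable_mk ?_ ?_)
  · refine lintegral_congr_ae (hg'.mono fun x hx => lintegral_congr_ae (hf'.mono fun y hy => ?_))
    simp only [hx, hy]
  · exact (lintegral_congr_ae (hf'.fun_comp (· ^ t))).symm.trans_le hfM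
  · exact (lintegral_congr_ae (hg'.fun_comp (· ^ r))).symm.trans_le hgM

end HardyLittlewoodSobolev

/-! ### Brezis–Lieb and weak convergence -/

section BrezisLieb

variable {β : Type*} [MeasurableSpace β] {ν : Measure β}

/-- The Brezis–Lieb form of dominated convergence: `F m` need not be dominated by a fixed integrable
function, but only up to a term `P m` tending to zero in mean and arbitrarily small multiples of an
`L¹`-bounded sequence `H m`. Dominated convergence is applied to the excess `F m - (P m + ε H m)`. -/
theorem tendsto_lintegral_zero_of_le_add {F H : ℕ → β → ℝ≥0∞} (hF : ∀ m, AEMeasurable (F m) ν)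
    (hH : ∀ m, AEMeasurable (H m) ν)
    (hF0 : ∀ᵐ x ∂ν, Tendsto (fun m => F m x) atTop (𝓝 0)) {M : ℝ≥0∞} (hM : M ≠ ⊤)
    (hHM : ∀ m, ∫⁻ x, H m x ∂ν ≤ M)
    (hdom : ∀ ε : NNReal, 0 < ε → ∃ (B : β → ℝ≥0∞) (P : ℕ → β → ℝ≥0∞), ∫⁻ x, B x ∂ν ≠ ⊤ ∧
      (∀ m, AEMeasurable (P m) ν) ∧ Tendsto (fun m => ∫⁻ x, P m x ∂ν) atTop (𝓝 0) ∧
      ∀ m, ∀ᵐ x ∂ν, F m x ≤ B x + (P m x + ε * H m x)) :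
    Tendsto (fun m => ∫⁻ x, F m x ∂ν) atTop (𝓝 0) := by
  rw [ENNReal.tendsto_nhds_zero]
  intro η hη
  have hη3 : η / 3 ≠ 0 := (ENNReal.div_pos hη.ne' (by norm_num)).ne'
  obtain ⟨ε, hε, hεM⟩ := ENNReal.exists_nnreal_pos_mul_lt hM hη3
  obtain ⟨B, P, hB, hP, hP0, hle⟩ := hdom ε hε
  have hW : Tendsto (fun m => ∫⁻ x, (F m x - (P m x + ε * H m x)) ∂ν) atTop (𝓝 0) := by
    have := tendsto_lintegral_of_dominated_convergence' (μ := ν) (f := fun _ => 0)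
      (F := fun m x => F m x - (P m x + ε * H m x)) B
      (fun m => (hF m).sub ((hP m).add ((hH m).const_mul _)))
      (fun m => (hle m).mono fun x hx => tsub_le_iff_right.2 hx) hB
      (hF0.mono fun x hx => tendsto_of_tendsto_of_tendsto_of_le_of_le tendsto_const_nhds hx
        (fun m => zero_le) (fun m => tsub_le_self))
    simpa using this
  filter_upwards [ENNReal.tendsto_nhds_zero.1 hW _ (pos_iff_ne_zero.2 hη3),
    ENNReal.tendsto_nhds_zero.1 hP0 _ (pos_iff_ne_zero.2 hη3)] with m h₁ h₂
  calc ∫⁻ x, F m x ∂ν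
      ≤ ∫⁻ x, ((F m x - (P m x + ε * H m x)) + (P m x + ε * H m x)) ∂ν :=
        lintegral_mono fun x => le_tsub_add
    _ = ∫⁻ x, (F m x - (P m x + ε * H m x)) ∂ν +
          (∫⁻ x, P m x ∂ν + ε * ∫⁻ x, H m x ∂ν) := by
        rw [lintegral_add_right' (g := fun x => P m x + ε * H m x) _
          ((hP m).add ((hH m).const_mul _)), lintegral_add_left' (hP m),
          lintegral_const_mul'' _ (hH m)]
    _ ≤ η / 3 + (η / 3 + η / 3) := by
        gcongr
        exact (mul_le_mul_right (hHM m) _).trans hεM.le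
    _ = η := by rw [← add_assoc, ENNReal.add_thirds]

/-- A sequence that is bounded in `L^r` and tends to zero almost everywhere tends weakly to zero. -/
theorem tendsto_lintegral_mul_zero {r r' : ℝ} (hr : r.HolderConjugate r') {ψ : β → ℝ≥0∞}
    (hψ : AEMeasurable ψ ν) (hψr : ∫⁻ x, ψ x ^ r' ∂ν ≠ ⊤) {k : ℕ → β → ℝ≥0∞}
    (hk : ∀ m, AEMeasurable (k m) ν) {M : ℝ≥0∞} (hM : M ≠ ⊤)
    (hkM : ∀ m, ∫⁻ x, k m x ^ r ∂ν ≤ M)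
    (hk0 : ∀ᵐ x ∂ν, Tendsto (fun m => k m x) atTop (𝓝 0)) :
    Tendsto (fun m => ∫⁻ x, ψ x * k m x ∂ν) atTop (𝓝 0) := by
  refine tendsto_lintegral_zero_of_le_add (fun m => hψ.mul (hk m)) (fun m => (hk m).pow_const r)
    ?_ hM hkM fun ε hε => ?_
  · filter_upwards [hk0, ae_lt_top' (hψ.pow_const r') hψr] with x hx hψx
    have hψx : ψ x ≠ ⊤ := fun h => by simp [h, hr.symm.pos] at hψx
    simpa using ENNReal.Tendsto.const_mul hx (Or.inr hψx)
  -- Young's inequality applied to `ψ k = (δ⁻¹ ψ) (δ k)` with `δ ^ r = ε`.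
  set δ : ℝ≥0∞ := (ε : ℝ≥0∞) ^ (1 / r) with hδ_def
  have hε0 : (ε : ℝ≥0∞) ≠ 0 := by simpa using hε.ne'
  have hδ0 : δ ≠ 0 := by simp [hδ_def, hε.ne']
  have hδt : δ ≠ ⊤ := ENNReal.rpow_ne_top_of_nonneg (one_div_nonneg.2 hr.nonneg) ENNReal.coe_ne_top
  have hδr : δ ^ r = ε := by
    rw [hδ_def, ← ENNReal.rpow_mul, one_div_mul_cancel hr.ne_zero, ENNReal.rpow_one]
  refine ⟨fun x => δ⁻¹ ^ r' * ψ x ^ r', fun _ _ => 0, ?_, fun m => aemeasurable_const, by simp,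
    fun m => ae_of_all _ fun x => ?_⟩
  · have : δ⁻¹ ^ r' ≠ ⊤ := ENNReal.rpow_ne_top_of_nonneg hr.symm.nonneg (by simp [hδ0])
    rw [lintegral_const_mul' _ _ this]
    finiteness
  have h1 : ∀ {s : ℝ}, 1 < s → ∀ a : ℝ≥0∞, a / ENNReal.ofReal s ≤ a := fun hs a =>
    ENNReal.div_le_of_le_mul (le_mul_of_one_le_right zero_le (by simpa using hs.le))
  calc ψ x * k m x = (δ⁻¹ * ψ x) * (δ * k m x) := by
        rw [mul_mul_mul_comm, ENNReal.inv_mul_cancel hδ0 hδt, one_mul]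
    _ ≤ (δ⁻¹ * ψ x) ^ r' / ENNReal.ofReal r' + (δ * k m x) ^ r / ENNReal.ofReal r :=
        ENNReal.young_inequality _ _ hr.symm
    _ ≤ (δ⁻¹ * ψ x) ^ r' + (δ * k m x) ^ r := add_le_add (h1 hr.symm.lt _) (h1 hr.lt _)
    _ = _ := by
        rw [ENNReal.mul_rpow_of_nonneg _ _ hr.nonneg, ENNReal.mul_rpow_of_nonneg _ _ hr.symm.nonneg,
          hδr, zero_add]

/-- Converse of Hölder's inequality: a nonnegative function whose pairing with the unit ball of
`L^r` is bounded lies in the dual space `L^{r'}`. -/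
theorem lintegral_rpow_le_of_forall_lintegral_mul_le [SigmaFinite ν] {r r' : ℝ}
    (hr : r.HolderConjugate r') {ψ : β → ℝ≥0∞} (hψ : Measurable ψ) {C : ℝ≥0∞}
    (h : ∀ g : β → ℝ≥0∞, Measurable g → ∫⁻ x, g x ^ r ∂ν ≤ 1 → ∫⁻ x, ψ x * g x ∂ν ≤ C) :
    ∫⁻ x, ψ x ^ r' ∂ν ≤ C ^ r' := by
  have hr'0 : 0 < r' := hr.symm.pos
  set ψ' : ℕ → β → ℝ≥0∞ := fun n => (spanningSets ν n).indicator fun x => min (ψ x) n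
  have hm : ∀ n, Measurable (ψ' n) := fun n =>
    (hψ.min measurable_const).indicator (measurableSet_spanningSets ν n)
  have hle : ∀ n x, ψ' n x ≤ ψ x := fun n x =>
    Set.indicator_apply_le' (fun _ => min_le_left _ _) (fun _ => zero_le)
  have hlim : ∀ x, Tendsto (fun n => ψ' n x ^ r') atTop (𝓝 (ψ x ^ r')) := fun x => by
    refine (ENNReal.continuous_rpow_const.tendsto _).comp ?_
    have h1 : Tendsto (fun n : ℕ => min (ψ x) n) atTop (𝓝 (min (ψ x) ⊤)) :=
      tendsto_const_nhds.min ENNReal.tendsto_nat_nhds_top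
    rw [min_top_right] at h1
    refine h1.congr' ?_
    filter_upwards [eventually_ge_atTop (spanningSetsIndex ν x)] with n hn
    exact (Set.indicator_of_mem (monotone_spanningSets ν hn (mem_spanningSetsIndex ν x))
      fun x => min (ψ x) (n : ℝ≥0∞)).symm
  have hbound : ∀ n, ∫⁻ x, ψ' n x ^ r' ∂ν ≤ C ^ r' := fun n => by
    set a := ∫⁻ x, ψ' n x ^ r' ∂ν with ha_def
    have hat : a ≠ ⊤ := by
      refine ne_top_of_le_ne_top (b := (n : ℝ≥0∞) ^ r' * ν (spanningSets ν n)) ?_ ?_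
      · have := (measure_spanningSets_lt_top ν n).ne
        finiteness
      · rw [← setLIntegral_const, ← lintegral_indicator (measurableSet_spanningSets ν n)]
        refine lintegral_mono fun x => ?_
        by_cases hx : x ∈ spanningSets ν n
        · simp only [ψ', Set.indicator_of_mem hx]
          exact ENNReal.rpow_le_rpow (min_le_right _ _) hr'0.le
        · simp [ψ', Set.indicator_of_notMem hx, hr'0]
    rcases eq_or_ne a 0 with ha0 | ha0
    · simp [ha0]
    -- The extremal test function `a ^ (-1 / r) ψ' ^ (r' - 1)`, of unit norm in `L^r`.
    have hex : (r' - 1) * r = r' := by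
      have := hr.symm.sub_one_mul_conj
      linarith
    have hg : ∫⁻ x, (a ^ (-(1 / r)) * ψ' n x ^ (r' - 1)) ^ r ∂ν ≤ 1 := by
      simp_rw [ENNReal.mul_rpow_of_nonneg _ _ hr.nonneg, ← ENNReal.rpow_mul, hex]
      rw [lintegral_const_mul _ ((hm n).pow_const _), ← ha_def, neg_mul,
        one_div_mul_cancel hr.ne_zero, ENNReal.rpow_neg_one, ENNReal.inv_mul_cancel ha0 hat]
    have key := h _ (((hm n).pow_const _).const_mul _) hg
    have : a ^ (1 / r') ≤ C := by
      refine le_trans ?_ key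
      calc a ^ (1 / r') = a ^ (-(1 / r)) * a := by
            conv_rhs => enter [2]; rw [← ENNReal.rpow_one a]
            rw [← ENNReal.rpow_add _ _ ha0 hat]
            congr 1
            have := hr.inv_add_inv_eq_one
            simp only [one_div]; linarith
        _ = ∫⁻ x, a ^ (-(1 / r)) * ψ' n x ^ r' ∂ν := by
            rw [lintegral_const_mul _ ((hm n).pow_const _)]
        _ ≤ _ := by
            refine lintegral_mono fun x => ?_
            rw [mul_left_comm]
            gcongr
            have hx : ψ' n x ^ r' = ψ' n x * ψ' n x ^ (r' - 1) := by
              conv_rhs => enter [1]; rw [← ENNReal.rpow_one (ψ' n x)]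
              rw [← ENNReal.rpow_add_of_nonneg _ _ zero_le_one hr.symm.sub_one_pos.le,
                add_sub_cancel]
            rw [hx]
            gcongr
            exact hle n x
    calc a = (a ^ (1 / r')) ^ r' := by
          rw [← ENNReal.rpow_mul, one_div_mul_cancel hr'0.ne', ENNReal.rpow_one]
      _ ≤ C ^ r' := by gcongr
  calc ∫⁻ x, ψ x ^ r' ∂ν = ∫⁻ x, liminf (fun n => ψ' n x ^ r') atTop ∂ν :=
        lintegral_congr fun x => (hlim x).liminf_eq.symm
    _ ≤ liminf (fun n => ∫⁻ x, ψ' n x ^ r' ∂ν) atTop :=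
        lintegral_liminf_le fun n => (hm n).pow_const _
    _ ≤ C ^ r' := (liminf_le_liminf (Eventually.of_forall hbound)).trans_eq (liminf_const _)

/-- One-variable Brezis–Lieb inequality, for every exponent `p > 0`: near `b / a = 0` it is the
continuity of `z ↦ |1 + z| ^ p`, elsewhere `|a|` is bounded by a multiple of `|b|`. -/
theorem exists_abs_rpow_add_sub_le {p : ℝ} (hp : 0 < p) {ε : ℝ} (hε : 0 < ε) :
    ∃ C : ℝ, 0 ≤ C ∧ ∀ a b : ℝ, |(|a + b| ^ p - |a| ^ p)| ≤ ε * |a| ^ p + C * |b| ^ p := by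
  have hc : ContinuousAt (fun z : ℝ => |1 + z| ^ p) 0 := by
    refine ContinuousAt.rpow_const (by fun_prop) (Or.inr hp.le)
  obtain ⟨δ, hδ, h⟩ := Metric.continuousAt_iff.1 hc ε hε
  refine ⟨(1 + 2 / δ) ^ p, by positivity, fun a b => ?_⟩
  have hC : 0 ≤ (1 + 2 / δ) ^ p * |b| ^ p := by positivity
  rcases le_or_gt |b| (δ / 2 * |a|) with hb | hb
  · rcases eq_or_ne a 0 with rfl | ha
    · have : b = 0 := by simpa using hb
      simp [this, hp.ne']
    have ha' : 0 < |a| := abs_pos.2 ha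
    have hz : |b / a| < δ := by
      rw [abs_div, div_lt_iff₀ ha']
      nlinarith
    have h1 := h (x := b / a) (by rwa [dist_zero_right, Real.norm_eq_abs])
    have h2 : |a + b| ^ p - |a| ^ p = |a| ^ p * (|1 + b / a| ^ p - |1 + (0 : ℝ)| ^ p) := by
      rw [mul_sub, ← Real.mul_rpow (abs_nonneg _) (abs_nonneg _), ← abs_mul, mul_add,
        mul_div_cancel₀ _ ha]
      simp
    rw [h2, abs_mul, abs_of_nonneg (by positivity : 0 ≤ |a| ^ p), mul_comm]
    have h3 : |(|1 + b / a| ^ p - |1 + (0 : ℝ)| ^ p)| ≤ ε := h1.le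
    have := mul_le_mul_of_nonneg_right h3 (by positivity : 0 ≤ |a| ^ p)
    linarith
  · have ha : |a| ≤ 2 / δ * |b| := by
      rw [div_mul_eq_mul_div, le_div_iff₀ hδ]
      linarith
    have h1 : |a| ^ p ≤ (1 + 2 / δ) ^ p * |b| ^ p := by
      rw [← Real.mul_rpow (by positivity) (abs_nonneg _)]
      exact Real.rpow_le_rpow (abs_nonneg _) (by linarith [abs_nonneg b]) hp.le
    have h2 : |a + b| ^ p ≤ (1 + 2 / δ) ^ p * |b| ^ p := by
      rw [← Real.mul_rpow (by positivity) (abs_nonneg _)]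
      exact Real.rpow_le_rpow (abs_nonneg _) (by linarith [abs_add_le a b]) hp.le
    have h3 : 0 ≤ |a| ^ p := by positivity
    have h4 : 0 ≤ |a + b| ^ p := by positivity
    rw [abs_sub_le_iff]
    constructor <;> nlinarith

/-- Two-variable Brezis–Lieb inequality. The cross terms, in which only one of the two factors
carries `b`, cannot be absorbed and are kept on the right. -/
theorem exists_abs_rpow_mul_rpow_sub_le {p q : ℝ} (hp : 0 < p) (hq : 0 < q) {ε : ℝ} (hε : 0 < ε) :
    ∃ C : ℝ, 0 ≤ C ∧ ∀ a b a' b' : ℝ,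
      |(|a + b| ^ p * |a' + b'| ^ q - |a| ^ p * |a'| ^ q - |b| ^ p * |b'| ^ q)| ≤
        C * (|b| ^ p * |b'| ^ q) + (C * (|b| ^ p * |a'| ^ q) + C * (|a| ^ p * |b'| ^ q)
          + ε * (|a| ^ p * |a'| ^ q)) := by
  -- The product of the two expansions carries `(2 e + e ^ 2) ≤ 3 e` in front of `|a|^p |a'|^q`.
  set e := min (ε / 3) 1
  have he : 0 < e := lt_min (by linarith) one_pos
  have he1 : e ≤ 1 := min_le_right _ _
  have he3 : e ≤ ε / 3 := min_le_left _ _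
  obtain ⟨C₁, hC₁, h₁⟩ := exists_abs_rpow_add_sub_le hp he
  obtain ⟨C₂, hC₂, h₂⟩ := exists_abs_rpow_add_sub_le hq he
  refine ⟨2 * C₁ + 2 * C₂ + C₁ * C₂ + 1, by positivity, fun a b a' b' => ?_⟩
  specialize h₁ a b
  specialize h₂ a' b'
  have hu : 0 ≤ |a| ^ p := by positivity
  have hv : 0 ≤ |b| ^ p := by positivity
  have hu' : 0 ≤ |a'| ^ q := by positivity
  have hv' : 0 ≤ |b'| ^ q := by positivity
  generalize |a + b| ^ p = U at *
  generalize |a' + b'| ^ q = U' at *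
  generalize |a| ^ p = u at *
  generalize |b| ^ p = v at *
  generalize |a'| ^ q = u' at *
  generalize |b'| ^ q = v' at *
  have huu := mul_nonneg hu hu'
  have hvv := mul_nonneg hv hv'
  have hvu := mul_nonneg hv hu'
  have huv := mul_nonneg hu hv'
  have hdec : U * U' - u * u' - v * v' =
      (U - u) * u' + u * (U' - u') + (U - u) * (U' - u') - v * v' := by ring
  have hprod : |U - u| * |U' - u'| ≤ (e * u + C₁ * v) * (e * u' + C₂ * v') :=
    mul_le_mul h₁ h₂ (abs_nonneg _) (by positivity)
  have hb : |U * U' - u * u' - v * v'| ≤ (e * u + C₁ * v) * u' + u * (e * u' + C₂ * v') +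
      (e * u + C₁ * v) * (e * u' + C₂ * v') + v * v' := by
    rw [hdec]
    refine (abs_sub _ _).trans (add_le_add ((abs_add_three _ _ _).trans ?_) (abs_of_nonneg hvv).le)
    rw [abs_mul, abs_mul, abs_mul, abs_of_nonneg hu, abs_of_nonneg hu']
    gcongr
  refine hb.trans ?_
  have i1 : e * e * (u * u') ≤ e * (u * u') := by
    gcongr; nlinarith
  have i2 : e * (u * u') ≤ ε / 3 * (u * u') := by gcongr
  have i3 : e * (C₁ * (v * u')) ≤ 1 * (C₁ * (v * u')) := by gcongr
  have i4 : e * (C₂ * (u * v')) ≤ 1 * (C₂ * (u * v')) := by gcongr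
  have j1 : 0 ≤ C₁ * (v * v') := by positivity
  have j2 : 0 ≤ C₂ * (v * v') := by positivity
  have j3 : 0 ≤ C₂ * (v * u') := by positivity
  have j4 : 0 ≤ C₁ * (u * v') := by positivity
  have j5 : 0 ≤ C₁ * C₂ * (v * u') := by positivity
  have j6 : 0 ≤ C₁ * C₂ * (u * v') := by positivity
  linarith

end BrezisLieb

/-! ### Duality for the Riesz potential -/

section RieszPairing

open Module

variable {E : Type*} [NormedAddCommGroup E] [NormedSpace ℝ E] [FiniteDimensional ℝ E]
  [MeasurableSpace E] [BorelSpace E] (μ : Measure E) [μ.IsAddHaarMeasure]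

/-- The Riesz potential maps `L^t` to `L^{r'}`, the dual of `L^r`. -/
theorem measurable_and_lintegral_riesz_rpow_ne_top (hd : 1 ≤ finrank ℝ E) {l t r r' : ℝ}
    (ht : 1 < t) (hr : r.HolderConjugate r') (hl : l < finrank ℝ E)
    (htr : 1 / t + 1 / r + l / finrank ℝ E = 2) {f : E → ℝ≥0∞} (hf : AEMeasurable f μ)
    (hft : ∫⁻ y, f y ^ t ∂μ ≠ ⊤) :
    Measurable (fun x => ∫⁻ y, ENNReal.ofReal (‖x - y‖ ^ (-l)) * f y ∂μ) ∧
      ∫⁻ x, (∫⁻ y, ENNReal.ofReal (‖x - y‖ ^ (-l)) * f y ∂μ) ^ r' ∂μ ≠ ⊤ := by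
  have hM : max (∫⁻ y, f y ^ t ∂μ) 1 ≠ ⊤ := by simp [hft]
  obtain ⟨C, hC, h⟩ := hardy_littlewood_sobolev μ hd ht hr.lt hl htr hM
  have hm : Measurable (fun x => ∫⁻ y, ENNReal.ofReal (‖x - y‖ ^ (-l)) * f y ∂μ) := by
    have h1 : ∀ x, ∫⁻ y, ENNReal.ofReal (‖x - y‖ ^ (-l)) * f y ∂μ =
        ∫⁻ y, ENNReal.ofReal (‖x - y‖ ^ (-l)) * hf.mk f y ∂μ := fun x =>
      lintegral_congr_ae (hf.ae_eq_mk.mono fun y hy => by simp only [hy])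
    simp_rw [h1]
    have h2 : Measurable fun z : E × E => ENNReal.ofReal (‖z.1 - z.2‖ ^ (-l)) * hf.mk f z.2 := by
      have := hf.measurable_mk
      fun_prop
    exact h2.lintegral_prod_right'
  refine ⟨hm, ne_top_of_le_ne_top (ENNReal.rpow_ne_top_of_nonneg hr.symm.nonneg hC)
    (lintegral_rpow_le_of_forall_lintegral_mul_le hr hm fun g hg hg1 => ?_)⟩
  refine le_trans (le_of_eq ?_)
    (h f g hf hg.aemeasurable (le_max_left _ _) (hg1.trans (le_max_right _ _)))
  refine lintegral_congr fun x => (lintegral_mul_const'' _ ?_).symm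
  exact AEMeasurable.mul (by fun_prop) hf

/-- If `f ∈ L^t` is fixed and `k m` is bounded in `L^r` and tends to zero almost everywhere, the
Riesz pairing of `f` with `k m` tends to zero: the potential of `f` lies in the dual of `L^r`, where
`k m` tends weakly to zero. -/
theorem tendsto_lintegral_riesz_zero (hd : 1 ≤ finrank ℝ E) {l t r : ℝ}
    (ht : 1 < t) (hr : 1 < r) (hl : l < finrank ℝ E)
    (htr : 1 / t + 1 / r + l / finrank ℝ E = 2) {f : E → ℝ≥0∞} (hf : AEMeasurable f μ)
    (hft : ∫⁻ y, f y ^ t ∂μ ≠ ⊤) {k : ℕ → E → ℝ≥0∞}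
    (hk : ∀ m, AEMeasurable (k m) μ) {M : ℝ≥0∞} (hM : M ≠ ⊤)
    (hkM : ∀ m, ∫⁻ x, k m x ^ r ∂μ ≤ M)
    (hk0 : ∀ᵐ x ∂μ, Tendsto (fun m => k m x) atTop (𝓝 0)) :
    Tendsto (fun m => ∫⁻ x, ∫⁻ y, ENNReal.ofReal (‖x - y‖ ^ (-l)) * f y * k m x ∂μ ∂μ)
      atTop (𝓝 0) := by
  have hrr := Real.HolderConjugate.conjExponent hr
  obtain ⟨h1, h2⟩ := measurable_and_lintegral_riesz_rpow_ne_top μ hd ht hrr hl htr hf hft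
  refine (tendsto_lintegral_mul_zero hrr h1.aemeasurable h2 hk hM hkM hk0).congr fun m => ?_
  refine lintegral_congr fun x => (lintegral_mul_const'' _ ?_).symm
  exact AEMeasurable.mul (by fun_prop) hf

end RieszPairing

/-! ### The Choquard energy -/

noncomputable section Choquard

variable {N : ℕ} {α p q s : ℝ}

/-- The normalising constant of the Riesz potential. -/
def rieszConst (N : ℕ) (α : ℝ) : ℝ :=
  Real.Gamma (((N : ℝ) - α) / 2) / (Real.pi ^ ((N : ℝ) / 2) * (2 : ℝ) ^ α * Real.Gamma (α / 2))

theorem rieszConst_nonneg (hα : 0 < α) (hαN : α < N) : 0 ≤ rieszConst N α := by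
  have h1 : 0 < Real.Gamma (((N : ℝ) - α) / 2) := Real.Gamma_pos_of_pos (by linarith)
  have h2 : 0 < Real.Gamma (α / 2) := Real.Gamma_pos_of_pos (by linarith)
  unfold rieszConst
  positivity

theorem rieszPotential_eq (x : EuclideanSpace ℝ (Fin N)) :
    rieszPotential N α x = rieszConst N α * ‖x‖ ^ (-((N : ℝ) - α)) := by
  rw [rieszPotential, rieszConst, neg_sub]
  ring

theorem rieszPotential_nonneg (hα : 0 < α) (hαN : α < N) (x : EuclideanSpace ℝ (Fin N)) :
    0 ≤ rieszPotential N α x := by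
  rw [rieszPotential_eq]
  have := rieszConst_nonneg hα hαN
  positivity

@[fun_prop]
theorem measurable_rieszPotential : Measurable (rieszPotential N α) := by
  unfold rieszPotential
  fun_prop

/-- The integrand of the Choquard energy written as a double integral; the first coordinate of `z`
is the outer variable `x`, the second the variable `y` of the convolution. -/
def choquardDensity (α p q : ℝ) (u : EuclideanSpace ℝ (Fin N) → ℝ)
    (z : EuclideanSpace ℝ (Fin N) × EuclideanSpace ℝ (Fin N)) : ℝ :=
  rieszPotential N α (z.1 - z.2) * (|u z.2| ^ p * |u z.1| ^ q)

/-- The pairing `∬ I_α(x - y) f(y) g(x)` of nonnegative functions. -/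
def rieszPairing (α : ℝ) (f g : EuclideanSpace ℝ (Fin N) → ℝ≥0∞) : ℝ≥0∞ :=
  ∫⁻ z : EuclideanSpace ℝ (Fin N) × EuclideanSpace ℝ (Fin N),
    ENNReal.ofReal (rieszPotential N α (z.1 - z.2)) * (f z.2 * g z.1)

theorem rieszPairing_eq (hα : 0 < α) (hαN : α < N) {f g : EuclideanSpace ℝ (Fin N) → ℝ≥0∞}
    (hf : AEMeasurable f) (hg : AEMeasurable g) :
    rieszPairing α f g = ENNReal.ofReal (rieszConst N α) *
      ∫⁻ x, ∫⁻ y, ENNReal.ofReal (‖x - y‖ ^ (-((N : ℝ) - α))) * f y * g x := by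
  have hm : AEMeasurable fun z : EuclideanSpace ℝ (Fin N) × EuclideanSpace ℝ (Fin N) =>
      ENNReal.ofReal (rieszPotential N α (z.1 - z.2)) * (f z.2 * g z.1) :=
    AEMeasurable.mul (by fun_prop) (hf.comp_snd.mul hg.comp_fst)
  rw [rieszPairing, Measure.volume_eq_prod, lintegral_prod _ hm,
    ← lintegral_const_mul' _ _ ENNReal.ofReal_ne_top]
  refine lintegral_congr fun x => ?_
  rw [← lintegral_const_mul' _ _ ENNReal.ofReal_ne_top]
  refine lintegral_congr fun y => ?_
  rw [rieszPotential_eq, ENNReal.ofReal_mul (rieszConst_nonneg hα hαN)]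
  ring

theorem rieszPairing_comm {f g : EuclideanSpace ℝ (Fin N) → ℝ≥0∞} :
    rieszPairing α f g = rieszPairing α g f := by
  rw [rieszPairing, rieszPairing, Measure.volume_eq_prod, ← lintegral_prod_swap]
  refine lintegral_congr fun z => ?_
  simp only [Prod.fst_swap, Prod.snd_swap, rieszPotential_eq, norm_sub_rev z.2 z.1]
  ring

theorem enorm_choquardDensity (hα : 0 < α) (hαN : α < N) (hp : 0 < p) (hq : 0 < q)
    (u : EuclideanSpace ℝ (Fin N) → ℝ)
    (z : EuclideanSpace ℝ (Fin N) × EuclideanSpace ℝ (Fin N)) :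
    ‖choquardDensity α p q u z‖ₑ =
      ENNReal.ofReal (rieszPotential N α (z.1 - z.2)) * (‖u z.2‖ₑ ^ p * ‖u z.1‖ₑ ^ q) := by
  rw [choquardDensity, Real.enorm_of_nonneg, ENNReal.ofReal_mul (rieszPotential_nonneg hα hαN _),
    ENNReal.ofReal_mul (by positivity), ← ENNReal.ofReal_rpow_of_nonneg (abs_nonneg _) hp.le,
    ← ENNReal.ofReal_rpow_of_nonneg (abs_nonneg _) hq.le, Real.enorm_eq_ofReal_abs,
    Real.enorm_eq_ofReal_abs]
  have := rieszPotential_nonneg hα hαN (z.1 - z.2)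
  positivity

theorem aestronglyMeasurable_choquardDensity {u : EuclideanSpace ℝ (Fin N) → ℝ}
    (hu : AEMeasurable u) : AEStronglyMeasurable (choquardDensity α p q u) := by
  refine AEMeasurable.aestronglyMeasurable ?_
  have h1 : AEMeasurable (fun z : EuclideanSpace ℝ (Fin N) × EuclideanSpace ℝ (Fin N) => u z.1) :=
    hu.comp_fst
  have h2 : AEMeasurable (fun z : EuclideanSpace ℝ (Fin N) × EuclideanSpace ℝ (Fin N) => u z.2) :=
    hu.comp_snd
  unfold choquardDensity
  refine AEMeasurable.mul (by fun_prop) ((h2.abs.pow_const p).mul (h1.abs.pow_const q))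

theorem rieszConv_eq_integral (u : EuclideanSpace ℝ (Fin N) → ℝ) (x : EuclideanSpace ℝ (Fin N)) :
    rieszConv α p u x = ∫ y, rieszPotential N α (x - y) * |u y| ^ p := by
  rw [rieszConv, convolution_def, ← integral_sub_left_eq_self _ volume x]
  simp

theorem integral_choquardDensity {u : EuclideanSpace ℝ (Fin N) → ℝ}
    (h : Integrable (choquardDensity α p q u)) :
    ∫ z, choquardDensity α p q u z = choquardIntegral α p q u := by
  rw [Measure.volume_eq_prod] at h ⊢
  rw [integral_prod _ h, choquardIntegral]
  refine integral_congr_ae (ae_of_all _ fun x => ?_)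
  simp only [choquardDensity, rieszConv_eq_integral]
  rw [← integral_mul_const]
  simp only [mul_assoc]

theorem lintegral_enorm_rpow_rpow {β : Type*} [MeasurableSpace β] {ν : Measure β} (hp : 0 < p)
    (u : β → ℝ) : ∫⁻ x, (‖u x‖ₑ ^ p) ^ (s / p) ∂ν = ∫⁻ x, ‖u x‖ₑ ^ s ∂ν := by
  simp_rw [← ENNReal.rpow_mul, mul_div_cancel₀ s hp.ne']

theorem integrable_choquardDensity (hα : 0 < α) (hαN : α < N) (hp : 0 < p) (hq : 0 < q)
    {u : EuclideanSpace ℝ (Fin N) → ℝ} (hu : AEMeasurable u)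
    (h : rieszPairing α (fun x => ‖u x‖ₑ ^ p) (fun x => ‖u x‖ₑ ^ q) ≠ ⊤) :
    Integrable (choquardDensity α p q u) := by
  refine ⟨aestronglyMeasurable_choquardDensity hu, ?_⟩
  rw [HasFiniteIntegral]
  simp_rw [enorm_choquardDensity hα hαN hp hq]
  exact h.lt_top

/-- Hardy–Littlewood–Sobolev for the Riesz pairing of `|u|^p` and `|v|^q`, with `u` and `v` in a
bounded subset of `L^s`. -/
theorem exists_rieszPairing_le (hN : 1 ≤ N) (hα : 0 < α) (hαN : α < N) (hp : 0 < p) (hq : 0 < q)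
    (hsp : 1 < s / p) (hsq : 1 < s / q)
    (hs : 1 / (s / p) + 1 / (s / q) + ((N : ℝ) - α) / N = 2) {M : ℝ≥0∞} (hM : M ≠ ⊤) :
    ∃ C : ℝ≥0∞, C ≠ ⊤ ∧ ∀ u v : EuclideanSpace ℝ (Fin N) → ℝ, AEMeasurable u → AEMeasurable v →
      ∫⁻ x, ‖u x‖ₑ ^ s ≤ M → ∫⁻ x, ‖v x‖ₑ ^ s ≤ M →
        rieszPairing α (fun x => ‖u x‖ₑ ^ p) (fun x => ‖v x‖ₑ ^ q) ≤ C := by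
  obtain ⟨C, hC, h⟩ := hardy_littlewood_sobolev (volume : Measure (EuclideanSpace ℝ (Fin N)))
    (by simpa using hN) hsp hsq (l := (N : ℝ) - α) (by simpa using hα) (by simpa using hs) hM
  refine ⟨ENNReal.ofReal (rieszConst N α) * C, by finiteness, fun u v hu hv huM hvM => ?_⟩
  rw [rieszPairing_eq hα hαN (hu.enorm.pow_const p) (hv.enorm.pow_const q)]
  gcongr
  refine h _ _ (hu.enorm.pow_const p) (hv.enorm.pow_const q) ?_ ?_
  · rwa [lintegral_enorm_rpow_rpow hp]
  · rwa [lintegral_enorm_rpow_rpow hq]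

/-- The cross terms of the Brezis–Lieb expansion vanish in the limit. -/
theorem tendsto_rieszPairing_zero (hN : 1 ≤ N) (hα : 0 < α) (hαN : α < N) (hp : 0 < p)
    (hq : 0 < q) (hsp : 1 < s / p) (hsq : 1 < s / q)
    (hs : 1 / (s / p) + 1 / (s / q) + ((N : ℝ) - α) / N = 2) {u : EuclideanSpace ℝ (Fin N) → ℝ}
    (hu : AEMeasurable u) (hus : ∫⁻ x, ‖u x‖ₑ ^ s ≠ ⊤) {v : ℕ → EuclideanSpace ℝ (Fin N) → ℝ}
    (hv : ∀ m, AEMeasurable (v m)) {M : ℝ≥0∞} (hM : M ≠ ⊤) (hvM : ∀ m, ∫⁻ x, ‖v m x‖ₑ ^ s ≤ M)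
    (hv0 : ∀ᵐ x, Tendsto (fun m => v m x) atTop (𝓝 0)) :
    Tendsto (fun m => rieszPairing α (fun x => ‖u x‖ₑ ^ p) (fun x => ‖v m x‖ₑ ^ q))
      atTop (𝓝 0) := by
  have h := tendsto_lintegral_riesz_zero (volume : Measure (EuclideanSpace ℝ (Fin N)))
    (by simpa using hN) hsp hsq (l := (N : ℝ) - α) (by simpa using hα) (by simpa using hs)
    (hu.enorm.pow_const p) (by rwa [lintegral_enorm_rpow_rpow hp])
    (k := fun m x => ‖v m x‖ₑ ^ q) (fun m => (hv m).enorm.pow_const q) hM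
    (fun m => by rw [lintegral_enorm_rpow_rpow hq]; exact hvM m)
    (hv0.mono fun x hx => by
      have h1 := (ENNReal.continuous_rpow_const (y := q)).tendsto _ |>.comp hx.enorm
      simpa [Function.comp_def, hq] using h1)
  have h2 := ENNReal.Tendsto.const_mul (a := ENNReal.ofReal (rieszConst N α)) h
    (Or.inr ENNReal.ofReal_ne_top)
  rw [mul_zero] at h2
  refine h2.congr fun m => ?_
  rw [rieszPairing_eq hα hαN (hu.enorm.pow_const p) ((hv m).enorm.pow_const q)]

/-- Fubini for the Choquard density gives the outer integrability. The convolution has to be finite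
also where `u` vanishes, which Fubini does not see; there the potential of `|u|^p` is finite because
it lies in a Lebesgue space. -/
theorem choquardFinite_of_lintegral (hN : 1 ≤ N) (hα : 0 < α) (hαN : α < N) (hp : 0 < p)
    (hq : 0 < q) (hsp : 1 < s / p) (hsq : 1 < s / q)
    (hs : 1 / (s / p) + 1 / (s / q) + ((N : ℝ) - α) / N = 2) {u : EuclideanSpace ℝ (Fin N) → ℝ}
    (hu : AEMeasurable u) (hus : ∫⁻ x, ‖u x‖ₑ ^ s ≠ ⊤) :
    Integrable (choquardDensity α p q u) ∧ ChoquardFinite α p q u := by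
  obtain ⟨C, hC, h⟩ := exists_rieszPairing_le hN hα hαN hp hq hsp hsq hs hus
  have hint := integrable_choquardDensity hα hαN hp hq hu
    (ne_top_of_le_ne_top hC (h u u hu hu le_rfl le_rfl))
  refine ⟨hint, ?_, ?_⟩
  · have hconj := Real.HolderConjugate.conjExponent hsq
    obtain ⟨h1, h2⟩ := measurable_and_lintegral_riesz_rpow_ne_top
      (volume : Measure (EuclideanSpace ℝ (Fin N))) (by simpa using hN) hsp hconj
      (l := (N : ℝ) - α) (by simpa using hα) (by simpa using hs) (hu.enorm.pow_const p)
      (by rwa [lintegral_enorm_rpow_rpow hp])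
    filter_upwards [ae_lt_top (h1.pow_const _) h2] with x hx
    have hx' := (ENNReal.rpow_lt_top_iff_of_pos hconj.symm.pos).1 hx
    have hI : Integrable fun y => rieszPotential N α (x - y) * |u y| ^ p := by
      refine ⟨(AEMeasurable.mul (by fun_prop) (hu.abs.pow_const p)).aestronglyMeasurable, ?_⟩
      rw [HasFiniteIntegral]
      have : ∀ y, ‖rieszPotential N α (x - y) * |u y| ^ p‖ₑ = ENNReal.ofReal (rieszConst N α) *
          (ENNReal.ofReal (‖x - y‖ ^ (-((N : ℝ) - α))) * ‖u y‖ₑ ^ p) := fun y => by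
        rw [Real.enorm_of_nonneg (mul_nonneg (rieszPotential_nonneg hα hαN _) (by positivity)),
          rieszPotential_eq, mul_assoc, ENNReal.ofReal_mul (rieszConst_nonneg hα hαN),
          ENNReal.ofReal_mul (by positivity), Real.enorm_eq_ofReal_abs,
          ENNReal.ofReal_rpow_of_nonneg (abs_nonneg _) hp.le]
      simp_rw [this]
      rw [lintegral_const_mul' _ _ ENNReal.ofReal_ne_top]
      exact ENNReal.mul_lt_top ENNReal.ofReal_lt_top hx'
    have := hI.comp_sub_left x
    simpa [ConvolutionExistsAt] using this
  · rw [Measure.volume_eq_prod] at hint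
    refine hint.integral_prod_left.congr (ae_of_all _ fun x => ?_)
    simp only [choquardDensity, rieszConv_eq_integral]
    rw [← integral_mul_const]
    simp only [mul_assoc]

/-- The Brezis–Lieb property of the Choquard energy in `L^s`. -/
theorem tendsto_choquardIntegral_sub (hN : 1 ≤ N) (hα : 0 < α) (hαN : α < N) (hp : 0 < p)
    (hq : 0 < q) (hsp : 1 < s / p) (hsq : 1 < s / q)
    (hs : 1 / (s / p) + 1 / (s / q) + ((N : ℝ) - α) / N = 2)
    {w : ℕ → EuclideanSpace ℝ (Fin N) → ℝ} {w₀ : EuclideanSpace ℝ (Fin N) → ℝ}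
    (hw : ∀ m, AEMeasurable (w m)) (hw₀ : AEMeasurable w₀) {M : ℝ≥0∞} (hM : M ≠ ⊤)
    (hwM : ∀ m, ∫⁻ x, ‖w m x‖ₑ ^ s ≤ M) (hvM : ∀ m, ∫⁻ x, ‖w m x - w₀ x‖ₑ ^ s ≤ M)
    (hw₀M : ∫⁻ x, ‖w₀ x‖ₑ ^ s ≤ M)
    (hae : ∀ᵐ x, Tendsto (fun m => w m x) atTop (𝓝 (w₀ x))) :
    Tendsto
      (fun m => choquardIntegral α p q (w m) - choquardIntegral α p q (fun x => w m x - w₀ x))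
      atTop (𝓝 (choquardIntegral α p q w₀)) := by
  have hv : ∀ m, AEMeasurable fun x => w m x - w₀ x := fun m => (hw m).sub hw₀
  have hw₀t : ∫⁻ x, ‖w₀ x‖ₑ ^ s ≠ ⊤ := ne_top_of_le_ne_top hM hw₀M
  have hfin : ∀ {u : EuclideanSpace ℝ (Fin N) → ℝ}, AEMeasurable u → ∫⁻ x, ‖u x‖ₑ ^ s ≤ M →
      Integrable (choquardDensity α p q u) := fun hu huM =>
    (choquardFinite_of_lintegral hN hα hαN hp hq hsp hsq hs hu (ne_top_of_le_ne_top hM huM)).1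
  have hiw := fun m => hfin (hw m) (hwM m)
  have hiv := fun m => hfin (hv m) (hvM m)
  have hi₀ := hfin hw₀ hw₀M
  rw [← integral_choquardDensity hi₀]
  simp_rw [← fun m => integral_choquardDensity (hiw m), ← fun m => integral_choquardDensity (hiv m),
    ← fun m => integral_sub (hiw m) (hiv m)]
  refine tendsto_integral_of_L1 _ hi₀.aestronglyMeasurable
    (Eventually.of_forall fun m => (hiw m).sub (hiv m)) ?_
  obtain ⟨C, hC, hpair⟩ := exists_rieszPairing_le hN hα hαN hp hq hsp hsq hs hM
  have hv0 : ∀ᵐ x, Tendsto (fun m => w m x - w₀ x) atTop (𝓝 0) := hae.mono fun x hx => by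
    simpa using hx.sub_const (w₀ x)
  refine tendsto_lintegral_zero_of_le_add
    (H := fun m z => ‖choquardDensity α p q (fun x => w m x - w₀ x) z‖ₑ)
    (fun m => (((hiw m).sub (hiv m)).sub hi₀).aestronglyMeasurable.enorm)
    (fun m => (hiv m).aestronglyMeasurable.enorm) ?_ hC (fun m => ?_) fun ε hε => ?_
  · -- Pointwise convergence at the pairs of points where `w m` converges.
    have h1 := Measure.quasiMeasurePreserving_fst (μ := (volume : Measure
      (EuclideanSpace ℝ (Fin N)))) (ν := (volume : Measure (EuclideanSpace ℝ (Fin N)))) |>.ae hae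
    have h2 := Measure.quasiMeasurePreserving_snd (μ := (volume : Measure
      (EuclideanSpace ℝ (Fin N)))) (ν := (volume : Measure (EuclideanSpace ℝ (Fin N)))) |>.ae hae
    rw [← Measure.volume_eq_prod] at h1 h2
    filter_upwards [h1, h2] with z hz1 hz2
    have key : ∀ {a : ℝ} (ha : 0 < a) {c : ℕ → ℝ} {c₀ : ℝ}, Tendsto c atTop (𝓝 c₀) →
        Tendsto (fun m => |c m| ^ a) atTop (𝓝 (|c₀| ^ a)) := fun ha _ _ hc =>
      hc.abs.rpow_const (Or.inr ha.le)
    have hd := ((((key hp hz2).mul (key hq hz1)).const_mul (rieszPotential N α (z.1 - z.2))).sub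
      (((key hp (hz2.sub_const (w₀ z.2))).mul (key hq (hz1.sub_const (w₀ z.1)))).const_mul
        (rieszPotential N α (z.1 - z.2)))).sub_const (choquardDensity α p q w₀ z)
    have hlim := hd.enorm
    simpa [choquardDensity, Real.zero_rpow hp.ne', Real.zero_rpow hq.ne'] using hlim
  · simp_rw [enorm_choquardDensity hα hαN hp hq]
    exact hpair _ _ (hv m) (hv m) (hvM m) (hvM m)
  · obtain ⟨D, hD, hle⟩ := exists_abs_rpow_mul_rpow_sub_le hp hq (ε := ε) (by exact_mod_cast hε)
    have hmK : Measurable fun z : EuclideanSpace ℝ (Fin N) × EuclideanSpace ℝ (Fin N) =>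
        ENNReal.ofReal (rieszPotential N α (z.1 - z.2)) := by fun_prop
    have hmP : ∀ {u v : EuclideanSpace ℝ (Fin N) → ℝ}, AEMeasurable u → AEMeasurable v →
        AEMeasurable fun z : EuclideanSpace ℝ (Fin N) × EuclideanSpace ℝ (Fin N) =>
          ENNReal.ofReal (rieszPotential N α (z.1 - z.2)) * (‖u z.2‖ₑ ^ p * ‖v z.1‖ₑ ^ q) :=
      fun hu hv => hmK.aemeasurable.mul
        ((hu.enorm.pow_const p).comp_snd.mul (hv.enorm.pow_const q).comp_fst)
    refine ⟨fun z => ENNReal.ofReal D * ‖choquardDensity α p q w₀ z‖ₑ,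
      fun m z => ENNReal.ofReal D * (ENNReal.ofReal (rieszPotential N α (z.1 - z.2)) *
          (‖w₀ z.2‖ₑ ^ p * ‖w m z.1 - w₀ z.1‖ₑ ^ q)) +
        ENNReal.ofReal D * (ENNReal.ofReal (rieszPotential N α (z.1 - z.2)) *
          (‖w m z.2 - w₀ z.2‖ₑ ^ p * ‖w₀ z.1‖ₑ ^ q)), ?_, fun m => ?_, ?_, fun m =>
        ae_of_all _ fun z => ?_⟩
    · rw [lintegral_const_mul' _ _ ENNReal.ofReal_ne_top]
      exact ENNReal.mul_ne_top ENNReal.ofReal_ne_top hi₀.2.ne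
    · exact ((hmP hw₀ (hv m)).const_mul _).add ((hmP (hv m) hw₀).const_mul _)
    · have t1 := tendsto_rieszPairing_zero hN hα hαN hp hq hsp hsq hs hw₀ hw₀t hv hM hvM hv0
      have t2 := tendsto_rieszPairing_zero hN hα hαN hq hp hsq hsp
        (by linarith : 1 / (s / q) + 1 / (s / p) + ((N : ℝ) - α) / N = 2) hw₀ hw₀t hv hM hvM hv0
      simp_rw [rieszPairing_comm (f := fun x => ‖w₀ x‖ₑ ^ q)] at t2
      have t := (ENNReal.Tendsto.const_mul (a := ENNReal.ofReal D) t1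
        (Or.inr ENNReal.ofReal_ne_top)).add (ENNReal.Tendsto.const_mul (a := ENNReal.ofReal D) t2
        (Or.inr ENNReal.ofReal_ne_top))
      simp only [mul_zero, add_zero] at t
      refine t.congr fun m => ?_
      rw [lintegral_add_left' ((hmP hw₀ (hv m)).const_mul _),
        lintegral_const_mul' _ _ ENNReal.ofReal_ne_top,
        lintegral_const_mul' _ _ ENNReal.ofReal_ne_top]
      rfl
    · have hk := rieszPotential_nonneg hα hαN (z.1 - z.2)
      have h := mul_le_mul_of_nonneg_left
        (hle (w m z.2 - w₀ z.2) (w₀ z.2) (w m z.1 - w₀ z.1) (w₀ z.1)) hk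
      simp only [sub_add_cancel] at h
      have hF : ‖choquardDensity α p q (w m) z -
          choquardDensity α p q (fun x => w m x - w₀ x) z - choquardDensity α p q w₀ z‖ₑ =
          ENNReal.ofReal (rieszPotential N α (z.1 - z.2) * |(|w m z.2| ^ p * |w m z.1| ^ q -
            |w m z.2 - w₀ z.2| ^ p * |w m z.1 - w₀ z.1| ^ q - |w₀ z.2| ^ p * |w₀ z.1| ^ q)|) := by
        rw [Real.enorm_eq_ofReal_abs, choquardDensity, choquardDensity, choquardDensity,
          ← mul_sub, ← mul_sub, abs_mul, abs_of_nonneg hk]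
      have hE : ∀ a b : ℝ, ENNReal.ofReal (|a| ^ p * |b| ^ q) = ‖a‖ₑ ^ p * ‖b‖ₑ ^ q := fun a b => by
        rw [ENNReal.ofReal_mul (by positivity), Real.enorm_eq_ofReal_abs, Real.enorm_eq_ofReal_abs,
          ENNReal.ofReal_rpow_of_nonneg (abs_nonneg _) hp.le,
          ENNReal.ofReal_rpow_of_nonneg (abs_nonneg _) hq.le]
      refine hF.trans_le ((ENNReal.ofReal_le_ofReal h).trans_eq ?_)
      simp only [enorm_choquardDensity hα hαN hp hq]
      rw [ENNReal.ofReal_mul hk, ENNReal.ofReal_add (by positivity) (by positivity),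
        ENNReal.ofReal_add (by positivity) (by positivity),
        ENNReal.ofReal_add (by positivity) (by positivity), ENNReal.ofReal_mul hD,
        ENNReal.ofReal_mul hD, ENNReal.ofReal_mul hD, ENNReal.ofReal_mul ε.coe_nonneg,
        hE, hE, hE, hE, ENNReal.ofReal_coe_nnreal]
      ring

end Choquard

theorem lemma2p2 (N : ℕ) (hN : 3 ≤ N) (α p q : ℝ) (hα : 0 < α) (hαN : α < (N : ℝ))
    (hp : 0 < p) (hq : 0 < q)
    (hlow : 2 * ((N : ℝ) + α) / (N : ℝ) < p + q)
    (hup : p + q < 2 * ((N : ℝ) + α) / ((N : ℝ) - 2))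
    (ht : 1 < (N : ℝ) * (p + q) / (((N : ℝ) + α) * p))
    (hr : 1 < (N : ℝ) * (p + q) / (((N : ℝ) + α) * q))
    (w : ℕ → EuclideanSpace ℝ (Fin N) → ℝ) (w₀ : EuclideanSpace ℝ (Fin N) → ℝ)
    (hbdd : BoundedInLp (ENNReal.ofReal ((N : ℝ) * (p + q) / ((N : ℝ) + α))) w)
    (hweak : TendstoWeaklyInLp (ENNReal.ofReal ((N : ℝ) * (p + q) / ((N : ℝ) + α))) w w₀)
    (hae : ∀ᵐ x, Tendsto (fun m => w m x) atTop (𝓝 (w₀ x))) :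
    (∀ m, ChoquardFinite α p q (w m)) ∧
    (∀ m, ChoquardFinite α p q (fun x => w m x - w₀ x)) ∧
    ChoquardFinite α p q w₀ ∧
    Tendsto
      (fun m => choquardIntegral α p q (w m) - choquardIntegral α p q (fun x => w m x - w₀ x))
      atTop (𝓝 (choquardIntegral α p q w₀)) := by
  have hN1 : 1 ≤ N := by omega
  have hN0 : (0 : ℝ) < N := by exact_mod_cast hN1
  set s := (N : ℝ) * (p + q) / ((N : ℝ) + α) with hs_def
  have hsp : 1 < s / p := by rwa [hs_def, div_div]
  have hsq : 1 < s / q := by rwa [hs_def, div_div]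
  have hs : 1 / (s / p) + 1 / (s / q) + ((N : ℝ) - α) / N = 2 := by
    rw [hs_def]
    have : p + q ≠ 0 := by positivity
    field_simp
    ring
  have hs1 : 1 < s := by
    rw [div_lt_iff₀ hN0] at hlow
    rw [hs_def, one_lt_div (by positivity)]
    linarith
  have hs0 : 0 < s := by linarith
  obtain ⟨hwL, B, hB⟩ := hbdd
  have hw₀L := hweak.2.1
  set b : ℝ≥0∞ := ENNReal.ofReal B + eLpNorm w₀ (ENNReal.ofReal s) volume with hb
  have hbt : b ≠ ⊤ := ENNReal.add_ne_top.2 ⟨ENNReal.ofReal_ne_top, hw₀L.2.ne⟩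
  have hM : b ^ s ≠ ⊤ := ENNReal.rpow_ne_top_of_nonneg hs0.le hbt
  have conv : ∀ u : EuclideanSpace ℝ (Fin N) → ℝ, eLpNorm u (ENNReal.ofReal s) volume ≤ b →
      ∫⁻ x, ‖u x‖ₑ ^ s ≤ b ^ s := fun u hu => by
    rw [eLpNorm_eq_lintegral_rpow_enorm_toReal (by simpa using hs0) ENNReal.ofReal_ne_top,
      ENNReal.toReal_ofReal hs0.le] at hu
    rwa [← ENNReal.rpow_le_rpow_iff (one_div_pos.2 hs0), ← ENNReal.rpow_mul b,
      mul_one_div_cancel hs0.ne', ENNReal.rpow_one]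
  have hwM := fun m => conv (w m) ((hB m).trans le_self_add)
  have hw₀M := conv w₀ le_add_self
  have hvM : ∀ m, ∫⁻ x, ‖w m x - w₀ x‖ₑ ^ s ≤ b ^ s := fun m =>
    conv (fun x => w m x - w₀ x) <|
      (eLpNorm_sub_le (hwL m).1 hw₀L.1 (by simpa using hs1.le)).trans
        (add_le_add (hB m) le_rfl)
  have hwm := fun m => (hwL m).1.aemeasurable
  have hw₀m := hw₀L.1.aemeasurable
  have fin : ∀ {u : EuclideanSpace ℝ (Fin N) → ℝ}, AEMeasurable u → ∫⁻ x, ‖u x‖ₑ ^ s ≤ b ^ s →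
      ChoquardFinite α p q u := fun hu huM =>
    (choquardFinite_of_lintegral hN1 hα hαN hp hq hsp hsq hs hu (ne_top_of_le_ne_top hM huM)).2
  exact ⟨fun m => fin (hwm m) (hwM m), fun m => fin ((hwm m).sub hw₀m) (hvM m), fin hw₀m hw₀M,
    tendsto_choquardIntegral_sub hN1 hα hαN hp hq hsp hsq hs hwm hw₀m hM hwM hvM hw₀M hae⟩
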